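/- **Setting.** Let $N\ge 2$ and let $\Omega\subset\mathbb R^N$ be a bounded connected open set with Lipschitz boundary. $H^1_0(\Omega)$ is the closure of $C_0^\infty(\Omega)$ in $H^1(\Omega)$, normed by $\|y\|_{H^1_0}=\|\nabla y\|_{L^2}$, and $H^{-1}(\Omega)$ is its dual. For a matrix $A$ put $A^{sym}=\frac12(A+A^t)$, $A^{skew}=\frac12(A-A^t)$. For skew-symmetric $A,B\in L^2(\Omega;\mathbb S^N_{skew})$ write $A\preceq B$ if $|a_{ij}|\le|b_{ij}|$ a.e. in $\Omega$ for all $i<j$. Fix constants $0<\alpha\le\beta$ and $c>0$, a nonzero $A^*\in L^2(\Omega;\mathbb S^N_{skew})$, and a convex compact set $Q\subset L^2(\Omega;\mathbb S^N_{skew})$ with $0\in Q$. Let - $\mathfrak A_{ad,1}$ be the set of symmetric $A\in L^\infty(\Omega;\mathbb S^N_{sym})$ with $\alpha I\le A(x)\le\beta I$ a.e. and total variation $TV(a_{ij})\le c$ for $i\le j$; - $U_{a,2}=\{B\in L^2(\Omega;\mathbb S^N_{skew}): B\preceq A^*\}$ and $\mathfrak A_{ad,2}=U_{a,2}\cap Q$;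 - $\mathfrak A_{ad}=\{A\in L^2(\Omega;\mathbb M^N): A^{sym}\in\mathfrak A_{ad,1},\ A^{skew}\in\mathfrak A_{ad,2}\}$, the set of admissible controls. For $A\in L^2(\Omega;\mathbb M^N)$, $D(A)$ is the set of $y\in H^1_0(\Omega)$ for which there is a constant $c_y$ with $\left|\int_\Omega(\nabla\varphi,A^{skew}\nabla y)\,dx\right|\le c_y\|\nabla\varphi\|_{L^2}$ for all $\varphi\in C_0^\infty(\Omega)$; for $y\in D(A)$, $w\in H^1_0(\Omega)$, $[y,w]_A$ is the limit of $\int_\Omega(\nabla\varphi,A^{skew}\nabla y)\,dx$ as $C_0^\infty(\Omega)\ni\varphi\to w$ in $H^1_0(\Omega)$. For $f\in H^{-1}(\Omega)$ and $y_d\in H^1_0(\Omega)$ consider the problem of minimizing $$I(A,y)=\|y-y_d\|_{L^2(\Omega)}^2+\int_\Omega\big(\nabla (y-y_d),A^{sym}\nabla (y-y_d)\big)\,dx$$ over the set $\Xi$ of pairs $(A,y)$ with $A\in\mathfrak A_{ad}$, $y\in D(A)$ and $\int_\Omega(A^{sym}\nabla y,\nabla w)\,dx+[y,w]_A=\langle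 f,w\rangle$ for all $w\in H^1_0(\Omega)$, i.e. $-\operatorname{div}(A\nabla y)=f$ in $\Omega$, $y=0$ on $\partial\Omega$. A pair in $\Xi$ is *optimal* if it minimizes $I$ over $\Xi$. *Regularized problems.* Given skew-symmetric $A^*_k\in L^\infty(\Omega;\mathbb S^N_{skew})$, $k\in\mathbb N$, let $\Xi_k$ be the set of pairs $(A,y)$ such that $A^{sym}\in\mathfrak A_{ad,1}$, $A^{skew}\in U_{a,2}$, $A^{skew}\preceq A_k^*$, $y\in H^1_0(\Omega)$ and $\int_\Omega(\nabla\varphi,A\nabla y)\,dx=\langle f,\varphi\rangle$ for all $\varphi\in C_0^\infty(\Omega)$. *Variational limit.* Write $(A_k,y_k)\xrightarrow{\tau}(A,y)$ if $A_k\to A$ strongly in $L^2(\Omega;\mathbb M^N)$ and $y_k\rightharpoonup y$ weakly in $H^1_0(\Omega)$. The problem $\langle\inf_\Xi I\rangle$ is the variational limit of $\langle\inf_{\Xi_k} I\rangle$ if: (d) for every $\delta>0$, every $(A,y)\in L^2(\Omega;\mathbb M^N)\times H^1_0(\Omega)$ is within $\delta$ in norm of the $\tau$-limit of some sequence in that space;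 (dd) if $n_k\to\infty$, $(A_k,y_k)\in\Xi_{n_k}$ and $(A_k,y_k)\xrightarrow{\tau}(A,y)$, then $(A,y)\in\Xi$ and $I(A,y)\le\liminf_k I(A_k,y_k)$; (ddd) for every $(A,y)\in\Xi$ there is $\widehat C>0$ such that for every $\delta>0$ there are $(A_k,y_k)$, belonging to $\Xi_k$ for all large $k$, and $(\widehat A,\widehat y)$ with $(A_k,y_k)\xrightarrow{\tau}(\widehat A,\widehat y)$, $\|A-\widehat A\|_{L^2}+\|y-\widehat y\|_{H^1_0}\le\delta$ and $I(A,y)\ge\limsup_k I(A_k,y_k)-\widehat C\delta$. An optimal pair is a *variational solution* if, for some sequence $A^*_k\in L^\infty(\Omega;\mathbb S^N_{skew})$ with $A^*_k\to A^*$ in $L^2$, the problem $\langle\inf_\Xi I\rangle$ is the variational limit of the problems $\langle\inf_{\Xi_k}I\rangle$. Otherwise it is a *non-variational* solution. **Lemma.** Suppose that there are $A_0\in\mathfrak A_{ad}$ and $v\in D(A_0)$ with $[v,v]_{A_0}<0$. Then there is $f\in H^{-1}(\Omega)$ with $f=-\operatorname{div}(A_0\nabla v)$, that is, $\langle f,\varphi\rangle=\int_\Omega(\nabla\varphi,A_0\nabla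 v)\,dx$ for all $\varphi\in C_0^\infty(\Omega)$, such that for this $f$ and $y_d=v$ the above problem has a non-variational optimal solution, namely $(A_0,v)$. The pair $(A_0,v)$ remains non-variational if in the definition of $\Xi_k$ the condition $A^{skew}\in U_{a,2}$ is replaced by $A^{skew}\in\mathfrak A_{ad,2}=U_{a,2}\cap Q$. -/

import Mathlib

open MeasureTheory Filter Topology TopologicalSpace
open scoped Distributions ENNReal NNReal

noncomputable section

namespace OCP

/-! ### Function spaces -/

/-- `ℝ^N` with the Euclidean norm. -/
abbrev Eu (N : ℕ) : Type := EuclideanSpace ℝ (Fin N)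

/-- `N × N` arrays of reals; the (product) norm is `max_{i,j} |a_ij|`. -/
abbrev Mat (N : ℕ) : Type := Fin N → Fin N → ℝ

variable {N : ℕ}

/-- Lebesgue measure on `Ω`. -/
abbrev leb (Ω : Opens (Eu N)) : Measure (Eu N) := volume.restrict (Ω : Set (Eu N))

/-- `L²(Ω)`. -/
abbrev L2 (Ω : Opens (Eu N)) : Type := Lp ℝ 2 (leb Ω)

/-- `L²(Ω; ℝ^N)`. -/
abbrev L2Vec (Ω : Opens (Eu N)) : Type := Lp (Eu N) 2 (leb Ω)

/-- `L²(Ω; 𝕄^N)`, with norm `(∫_Ω (max_{i,j} |a_ij(x)|)² dx)^{1/2}`. -/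
abbrev L2Mat (Ω : Opens (Eu N)) : Type := Lp (Mat N) 2 (leb Ω)

/-- `Ω` has a Lipschitz boundary: near each boundary point, after choosing a unit vector `n`, `Ω` is
the strict epigraph in direction `n` of a Lipschitz function of the component orthogonal to `n`. -/
def HasLipschitzBoundary (Ω : Opens (Eu N)) : Prop :=
  ∀ x₀ ∈ frontier (Ω : Set (Eu N)), ∃ n : Eu N, ‖n‖ = 1 ∧ ∃ r : ℝ, 0 < r ∧
    ∃ (K : ℝ≥0) (γ : Eu N → ℝ), LipschitzWith K γ ∧
      ∀ x ∈ Metric.ball x₀ r, x ∈ Ω ↔ γ (x - inner ℝ n x • n) < inner ℝ n x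

variable {Ω : Opens (Eu N)}

theorem memLp_test (φ : 𝓓(Ω, ℝ)) : MemLp (φ : Eu N → ℝ) 2 (leb Ω) :=
  φ.continuous.memLp_of_hasCompactSupport φ.hasCompactSupport

theorem continuous_gradient_test (φ : 𝓓(Ω, ℝ)) : Continuous (gradient (φ : Eu N → ℝ)) :=
  (InnerProductSpace.toDual ℝ (Eu N)).symm.continuous.comp
    (φ.contDiff.continuous_fderiv (by simp))

theorem hasCompactSupport_gradient_test (φ : 𝓓(Ω, ℝ)) :
    HasCompactSupport (gradient (φ : Eu N → ℝ)) :=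
  (φ.hasCompactSupport.fderiv ℝ).comp_left (map_zero _)

theorem memLp_gradient_test (φ : 𝓓(Ω, ℝ)) :
    MemLp (gradient (φ : Eu N → ℝ)) 2 (leb Ω) :=
  (continuous_gradient_test φ).memLp_of_hasCompactSupport (hasCompactSupport_gradient_test φ)

theorem differentiableAt_test (φ : 𝓓(Ω, ℝ)) (x : Eu N) :
    DifferentiableAt ℝ (φ : Eu N → ℝ) x :=
  (φ.contDiff.differentiable (by simp)).differentiableAt

/-- `φ ↦ (φ, ∇φ)` from `C_0^∞(Ω)` to `L²(Ω) × L²(Ω; ℝ^N)`. -/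
def testPair (Ω : Opens (Eu N)) : 𝓓(Ω, ℝ) →ₗ[ℝ] L2 Ω × L2Vec Ω where
  toFun φ := ((memLp_test φ).toLp, (memLp_gradient_test φ).toLp)
  map_add' φ ψ := by
    refine Prod.ext ?_ ?_
    · exact (MemLp.toLp_add (memLp_test φ) (memLp_test ψ))
    · refine Eq.trans ?_ (MemLp.toLp_add (memLp_gradient_test φ) (memLp_gradient_test ψ))
      refine MemLp.toLp_congr (memLp_gradient_test (φ + ψ)) _ (ae_of_all _ fun x => ?_)
      have h : ((φ + ψ : 𝓓(Ω, ℝ)) : Eu N → ℝ) = (φ : Eu N → ℝ) + ψ := rfl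
      simp only [gradient, h, Pi.add_apply]
      rw [fderiv_add (differentiableAt_test φ x) (differentiableAt_test ψ x), map_add]
  map_smul' c φ := by
    refine Prod.ext ?_ ?_
    · exact (MemLp.toLp_const_smul c (memLp_test φ))
    · refine Eq.trans ?_ (MemLp.toLp_const_smul c (memLp_gradient_test φ))
      refine MemLp.toLp_congr (memLp_gradient_test (c • φ)) _ (ae_of_all _ fun x => ?_)
      have h : ((c • φ : 𝓓(Ω, ℝ)) : Eu N → ℝ) = c • (φ : Eu N → ℝ) := rfl
      simp only [gradient, h, Pi.smul_apply]
      rw [fderiv_const_smul (differentiableAt_test φ x), map_smul]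

/-- `H^1_0(Ω)`, the closure of `C_0^∞(Ω)` in `H^1(Ω)`; an element is stored together with its weak
gradient, as the pair `(y, ∇y)`, and the topology is that of `H^1(Ω)`. -/
def H10 (Ω : Opens (Eu N)) : Submodule ℝ (L2 Ω × L2Vec Ω) :=
  (LinearMap.range (testPair Ω)).topologicalClosure

/-- The underlying function of an element of `H^1_0(Ω)`. -/
def val (y : H10 Ω) : L2 Ω := y.1.1

/-- The weak gradient of an element of `H^1_0(Ω)`; `‖grad y‖` is the norm used on `H^1_0(Ω)`. -/
def grad (y : H10 Ω) : L2Vec Ω := y.1.2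

/-- The inclusion of `C_0^∞(Ω)` in `H^1_0(Ω)`. -/
def ofTest (φ : 𝓓(Ω, ℝ)) : H10 Ω :=
  ⟨testPair Ω φ, Submodule.le_topologicalClosure _ ⟨φ, rfl⟩⟩

/-- `H^{-1}(Ω)`, the dual of `H^1_0(Ω)`. -/
abbrev Hm1 (Ω : Opens (Eu N)) : Type := H10 Ω →L[ℝ] ℝ

/-! ### Symmetric and skew-symmetric matrices -/

/-- `b ↦ (b + bᵗ)/2` -/
def symL (N : ℕ) : Mat N →L[ℝ] Mat N :=
  LinearMap.toContinuousLinearMap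
    { toFun := fun b i j => (1 / 2 : ℝ) * (b i j + b j i)
      map_add' := by intro a b; ext i j; simp only [Pi.add_apply]; ring
      map_smul' := by
        intro c a; ext i j; simp only [Pi.smul_apply, smul_eq_mul, RingHom.id_apply]; ring }

/-- `b ↦ (b - bᵗ)/2` -/
def skewL (N : ℕ) : Mat N →L[ℝ] Mat N :=
  LinearMap.toContinuousLinearMap
    { toFun := fun b i j => (1 / 2 : ℝ) * (b i j - b j i)
      map_add' := by intro a b; ext i j; simp only [Pi.add_apply]; ring
      map_smul' := by
        intro c a; ext i j; simp only [Pi.smul_apply, smul_eq_mul, RingHom.id_apply]; ring }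

/-- `A^sym`. -/
def symPart (A : L2Mat Ω) : L2Mat Ω := (symL N).compLp A

/-- `A^skew`. -/
def skewPart (A : L2Mat Ω) : L2Mat Ω := (skewL N).compLp A

/-- `A ∈ L²(Ω; 𝕊^N_sym)`. -/
def IsSym (A : L2Mat Ω) : Prop := ∀ᵐ x ∂(leb Ω), ∀ i j, A x i j = A x j i

/-- `A ∈ L²(Ω; 𝕊^N_skew)`. -/
def IsSkew (A : L2Mat Ω) : Prop := ∀ᵐ x ∂(leb Ω), ∀ i j, A x i j = -A x j i

/-- The relation `A ⪯ B` a.e. in `Ω`: `|a_ij| ≤ |b_ij|` a.e. for all `i < j`. -/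
def Preceq (A B : L2Mat Ω) : Prop :=
  ∀ᵐ x ∂(leb Ω), ∀ i j : Fin N, i < j → |A x i j| ≤ |B x i j|

/-- `(ξ, a η)_{ℝ^N}`. -/
def mform (a : Mat N) (ξ η : Eu N) : ℝ := ξ.ofLp ⬝ᵥ (Matrix.of a).mulVec η.ofLp

/-- `∫_Ω (g, B h)_{ℝ^N} dx`. -/
def pairing (B : L2Mat Ω) (g h : L2Vec Ω) : ℝ := ∫ x in (Ω : Set (Eu N)), mform (B x) (g x) (h x)

/-! ### The unbounded form associated with a matrix -/

/-- The set `D(A)`. -/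
def domD (A : L2Mat Ω) : Set (H10 Ω) :=
  {y | ∃ c : ℝ, ∀ φ : 𝓓(Ω, ℝ),
    |pairing (skewPart A) (grad (ofTest φ)) (grad y)| ≤ c * ‖grad (ofTest φ)‖}

/-- The extended form `[y, w]_A` for `y ∈ D(A)`, `w ∈ H^1_0(Ω)`: the limit of
`∫_Ω (∇φ, A^skew ∇y) dx` as the test function `φ` tends to `w` in `H^1_0(Ω)`. -/
def bracket (A : L2Mat Ω) (y w : H10 Ω) : ℝ :=
  @limUnder ℝ _ _ ⟨0⟩ (comap (ofTest (Ω := Ω)) (𝓝 w))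
    (fun φ => pairing (skewPart A) (grad (ofTest φ)) (grad y))

theorem denseRange_ofTest : DenseRange (ofTest (Ω := Ω)) := by
  intro w
  rw [mem_closure_iff_nhds]
  intro t ht
  obtain ⟨u, hu, hut⟩ := (mem_nhds_subtype _ _ _).1 ht
  have hw : (w : L2 Ω × L2Vec Ω) ∈ closure (LinearMap.range (testPair Ω) : Set _) := w.2
  obtain ⟨_, hzu, φ, rfl⟩ := mem_closure_iff_nhds.1 hw u hu
  exact ⟨ofTest φ, hut hzu, φ, rfl⟩

theorem mform_abs_le (a : Mat N) (ξ η : Eu N) :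
    |mform a ξ η| ≤ (N : ℝ) ^ 2 * (‖ξ‖ * (‖a‖ * ‖η‖)) := by
  have h : mform a ξ η = ∑ i, ∑ j, ξ i * (a i j * η j) := by
    simp [mform, dotProduct, Matrix.mulVec, Finset.mul_sum]
  rw [h]
  refine (Finset.abs_sum_le_sum_abs _ _).trans ?_
  have hb : ∀ i ∈ (Finset.univ : Finset (Fin N)),
      |∑ j, ξ i * (a i j * η j)| ≤ (N : ℝ) * (‖ξ‖ * (‖a‖ * ‖η‖)) := by
    intro i _
    refine (Finset.abs_sum_le_sum_abs _ _).trans ?_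
    have hc : ∀ j ∈ (Finset.univ : Finset (Fin N)),
        |ξ i * (a i j * η j)| ≤ ‖ξ‖ * (‖a‖ * ‖η‖) := by
      intro j _
      rw [abs_mul, abs_mul]
      have h1 : |ξ i| ≤ ‖ξ‖ := PiLp.norm_apply_le ξ i
      have h2 : |η j| ≤ ‖η‖ := PiLp.norm_apply_le η j
      have h3 : |a i j| ≤ ‖a‖ := (norm_le_pi_norm (a i) j).trans (norm_le_pi_norm a i)
      gcongr
    simpa using Finset.sum_le_card_nsmul _ _ _ hc
  have := Finset.sum_le_card_nsmul _ _ _ hb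
  simp only [Finset.card_univ, Fintype.card_fin, nsmul_eq_mul] at this
  linarith [this]

theorem continuous_mform : Continuous fun p : Mat N × Eu N × Eu N => mform p.1 p.2.1 p.2.2 := by
  simp only [mform, dotProduct, Matrix.mulVec, Matrix.of_apply]
  fun_prop

theorem grad_ofTest_ae (φ : 𝓓(Ω, ℝ)) :
    grad (ofTest φ) =ᵐ[leb Ω] gradient (φ : Eu N → ℝ) :=
  MemLp.coeFn_toLp (memLp_gradient_test φ)

/-- `(∇φ, B h)` is integrable for a test function `φ`, `B ∈ L²` and `h ∈ L²`. -/
theorem integrable_mform_test (B : L2Mat Ω) (φ : 𝓓(Ω, ℝ)) (h : L2Vec Ω) :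
    Integrable (fun x => mform (B x) (grad (ofTest φ) x) (h x)) (leb Ω) := by
  obtain ⟨C, hC⟩ := (continuous_gradient_test φ).bounded_above_of_compact_support
    (hasCompactSupport_gradient_test φ)
  have hBh : Integrable (fun x => ‖B x‖ * ‖h x‖) (leb Ω) :=
    (Lp.memLp B).norm.integrable_mul (Lp.memLp h).norm
  refine (hBh.const_mul ((N : ℝ) ^ 2 * C)).mono' ?_ ?_
  · exact continuous_mform.comp_aestronglyMeasurable
      ((Lp.aestronglyMeasurable B).prodMk
        ((Lp.aestronglyMeasurable _).prodMk (Lp.aestronglyMeasurable h)))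
  · filter_upwards [grad_ofTest_ae φ] with x hx
    rw [Real.norm_eq_abs]
    refine (mform_abs_le _ _ _).trans ?_
    rw [hx, mul_assoc]
    gcongr
    exact hC x

theorem mform_sub_left (a : Mat N) (ξ ξ' η : Eu N) :
    mform a (ξ - ξ') η = mform a ξ η - mform a ξ' η := by
  simp [mform, sub_dotProduct]

/-- For `y ∈ D(A)` the limit defining `[y, w]_A` exists. -/
theorem tendsto_bracket {A : L2Mat Ω} {y : H10 Ω} (hy : y ∈ domD A) (w : H10 Ω) :
    Tendsto (fun φ => pairing (skewPart A) (grad (ofTest φ)) (grad y))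
      (comap (ofTest (Ω := Ω)) (𝓝 w)) (𝓝 (bracket A y w)) := by
  obtain ⟨c, hc⟩ := hy
  have hne : (comap (ofTest (Ω := Ω)) (𝓝 w)).NeBot :=
    comap_neBot_iff_frequently.2 (mem_closure_iff_frequently.1 (denseRange_ofTest w))
  have hsub : ∀ φ ψ : 𝓓(Ω, ℝ), ofTest (φ - ψ) = ofTest φ - ofTest ψ := fun φ ψ =>
    Subtype.ext (map_sub (testPair Ω) φ ψ)
  have hgsub : ∀ u v : H10 Ω, grad (u - v) = grad u - grad v := fun _ _ => rfl
  have hlin : ∀ φ ψ : 𝓓(Ω, ℝ), pairing (skewPart A) (grad (ofTest (φ - ψ))) (grad y) =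
      pairing (skewPart A) (grad (ofTest φ)) (grad y) -
        pairing (skewPart A) (grad (ofTest ψ)) (grad y) := by
    intro φ ψ
    unfold pairing
    rw [← integral_sub (integrable_mform_test _ φ _) (integrable_mform_test _ ψ _)]
    refine integral_congr_ae ?_
    rw [hsub, hgsub]
    filter_upwards [Lp.coeFn_sub (grad (ofTest φ)) (grad (ofTest ψ))] with x hx
    rw [hx, Pi.sub_apply, mform_sub_left]
  have hcau : Cauchy (map (fun φ => pairing (skewPart A) (grad (ofTest φ)) (grad y))
      (comap (ofTest (Ω := Ω)) (𝓝 w))) := by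
    rw [Metric.cauchy_iff]
    refine ⟨hne.map _, fun ε hε => ?_⟩
    have hd : 0 < ε / (2 * (|c| + 1)) := by positivity
    refine ⟨_, image_mem_map (preimage_mem_comap (Metric.ball_mem_nhds w hd)), ?_⟩
    rintro _ ⟨φ, hφ, rfl⟩ _ ⟨ψ, hψ, rfl⟩
    rw [Real.dist_eq, ← hlin]
    refine (hc _).trans_lt ?_
    have h1 : ‖grad (ofTest (φ - ψ))‖ ≤ dist (ofTest φ) (ofTest ψ) := by
      rw [hsub, dist_eq_norm]
      exact norm_snd_le (ofTest φ - ofTest ψ : H10 Ω).1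
    have h2 : dist (ofTest φ) (ofTest ψ) < 2 * (ε / (2 * (|c| + 1))) := by
      have := dist_triangle_right (ofTest φ) (ofTest ψ) w
      have a1 : dist (ofTest φ) w < _ := hφ
      have a2 : dist (ofTest ψ) w < _ := hψ
      linarith
    calc c * ‖grad (ofTest (φ - ψ))‖ ≤ (|c| + 1) * dist (ofTest φ) (ofTest ψ) := by
          gcongr
          linarith [le_abs_self c]
      _ < (|c| + 1) * (2 * (ε / (2 * (|c| + 1)))) := by gcongr
      _ = ε := by field_simp
  exact tendsto_nhds_limUnder (CompleteSpace.complete hcau)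

/-! ### Admissible controls -/

/-- The total variation on `Ω`: the supremum of `∫_Ω g div φ dx` over the compactly supported `C¹`
vector fields `φ` in `Ω` with `|φ| ≤ 1`. -/
def totalVariation (Ω : Opens (Eu N)) (g : Eu N → ℝ) : EReal :=
  ⨆ φ : {φ : 𝓓^{1}(Ω, Eu N) // ∀ x, ‖φ x‖ ≤ 1},
    ((∫ x in (Ω : Set (Eu N)),
      g x * ∑ i, (fderiv ℝ φ.1 x (EuclideanSpace.single i 1)) i : ℝ) : EReal)

/-- The fixed data of the class of controls: the constants `α`, `β`, `c`, the nonzero skew-symmetric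
matrix `A^*`, and the convex compact set `Q` of skew-symmetric matrices that contains `0`. -/
structure ControlData (Ω : Opens (Eu N)) where
  α : ℝ
  β : ℝ
  c : ℝ
  Astar : L2Mat Ω
  Q : Set (L2Mat Ω)
  α_pos : 0 < α
  α_le_β : α ≤ β
  c_pos : 0 < c
  Astar_skew : IsSkew Astar
  Astar_ne_zero : Astar ≠ 0
  Q_skew : ∀ B ∈ Q, IsSkew B
  Q_convex : Convex ℝ Q
  Q_compact : IsCompact Q
  zero_mem_Q : (0 : L2Mat Ω) ∈ Q

namespace ControlData

variable (D : ControlData Ω)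

/-- Symmetric matrices all of whose entries have total variation at most `c`. (Only the intersection
with the bounded matrices of `Ub1` is used, so nothing is lost by working inside `L²`.) -/
def Ua1 : Set (L2Mat Ω) :=
  {A | IsSym A ∧ ∀ i j : Fin N, i ≤ j → totalVariation Ω (fun x => A x i j) ≤ (D.c : EReal)}

/-- The class `𝔐_α^β(Ω)`: bounded symmetric matrices with `α I ≤ A(x) ≤ β I` a.e. in `Ω`. -/
def Ub1 : Set (L2Mat Ω) :=
  {A | IsSym A ∧ MemLp A ∞ (leb Ω) ∧
    ∀ᵐ x ∂(leb Ω), ∀ ξ : Eu N,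
      D.α * ‖ξ‖ ^ 2 ≤ mform (A x) ξ ξ ∧ mform (A x) ξ ξ ≤ D.β * ‖ξ‖ ^ 2}

/-- Skew-symmetric matrices with `A ⪯ A^*`. -/
def Ua2 : Set (L2Mat Ω) := {A | IsSkew A ∧ Preceq A D.Astar}

/-- Skew-symmetric matrices in `Q`. -/
def Ub2 : Set (L2Mat Ω) := {A | IsSkew A ∧ A ∈ D.Q}

/-- `𝔄_{ad,1}`. -/
def Aad1 : Set (L2Mat Ω) := D.Ua1 ∩ D.Ub1

/-- `𝔄_{ad,2}`. -/
def Aad2 : Set (L2Mat Ω) := D.Ua2 ∩ D.Ub2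

/-- The admissible controls `𝔄_ad`. -/
def Aad : Set (L2Mat Ω) := {A | symPart A ∈ D.Aad1 ∧ skewPart A ∈ D.Aad2}

/-! ### The optimal control problem and its regularizations -/

/-- The set `Ξ` of admissible pairs for the right-hand side `f`: `A ∈ 𝔄_ad`, `y ∈ D(A)` and
`∫_Ω (A^sym ∇y, ∇w) dx + [y, w]_A = ⟨f, w⟩` for all `w ∈ H^1_0(Ω)`. -/
def Xi (f : Hm1 Ω) : Set (L2Mat Ω × H10 Ω) :=
  {p | p.1 ∈ D.Aad ∧ p.2 ∈ domD p.1 ∧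
    ∀ w : H10 Ω, pairing (symPart p.1) (grad w) (grad p.2) + bracket p.1 p.2 w = f w}

/-- The admissible pairs of the regularized problem: the control is a sum of a symmetric part in
`𝔄_{ad,1}` and a skew-symmetric part `B` in `R` with `B ⪯ A^*_k`, and `y ∈ H^1_0(Ω)` is a weak
solution of `-div (A ∇y) = f`, tested with `C_0^∞(Ω)`. -/
def XiReg (R : Set (L2Mat Ω)) (Ak : L2Mat Ω) (f : Hm1 Ω) : Set (L2Mat Ω × H10 Ω) :=
  {p | symPart p.1 ∈ D.Aad1 ∧
    skewPart p.1 ∈ R ∩ {B | IsSkew B ∧ Preceq B Ak} ∧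
    ∀ φ : 𝓓(Ω, ℝ), pairing p.1 (grad (ofTest φ)) (grad p.2) = f (ofTest φ)}

end ControlData

/-- The cost `‖y - y_d‖²_{L²(Ω)} + ∫_Ω (∇(y - y_d), A^sym ∇(y - y_d)) dx`. -/
def cost (yd : H10 Ω) (p : L2Mat Ω × H10 Ω) : ℝ :=
  ‖val p.2 - val yd‖ ^ 2 + pairing (symPart p.1) (grad p.2 - grad yd) (grad p.2 - grad yd)

/-- Convergence of sequences in the product of the strong topology of `L²(Ω; 𝕄^N)` and the weak
topology of `H^1_0(Ω)`. -/
def TauTendsto (p : ℕ → L2Mat Ω × H10 Ω) (q : L2Mat Ω × H10 Ω) : Prop :=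
  Tendsto (fun k => (p k).1) atTop (𝓝 q.1) ∧
    ∀ l : Hm1 Ω, Tendsto (fun k => l (p k).2) atTop (𝓝 (l q.2))

/-- `‖u - u'‖ + ‖y - y'‖` in `L²(Ω; 𝕄^N) × H^1_0(Ω)`. -/
def gap (p q : L2Mat Ω × H10 Ω) : ℝ := ‖p.1 - q.1‖ + ‖grad (p.2 - q.2)‖

/-- The problem `⟨inf_Ξ I⟩` is the variational limit, as `k → ∞`, of the problems
`⟨inf_{Ξ_k} I_k⟩`, all posed in `L²(Ω; 𝕄^N) × H^1_0(Ω)` with the convergence `TauTendsto`. -/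
structure IsVariationalLimit (Xk : ℕ → Set (L2Mat Ω × H10 Ω)) (Ik : ℕ → L2Mat Ω × H10 Ω → ℝ)
    (X : Set (L2Mat Ω × H10 Ω)) (I : L2Mat Ω × H10 Ω → ℝ) : Prop where
  approx : ∀ δ : ℝ, 0 < δ → ∀ p : L2Mat Ω × H10 Ω, ∃ q : L2Mat Ω × H10 Ω,
    ∃ s : ℕ → L2Mat Ω × H10 Ω, gap p q ≤ δ ∧ TauTendsto s q
  liminf_le : ∀ (n : ℕ → ℕ) (s : ℕ → L2Mat Ω × H10 Ω) (p : L2Mat Ω × H10 Ω),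
    Tendsto n atTop atTop → (∀ k, s k ∈ Xk (n k)) → TauTendsto s p →
      p ∈ X ∧ (I p : EReal) ≤ liminf (fun k => (Ik (n k) (s k) : EReal)) atTop
  recovery : ∀ p ∈ X, ∃ C : ℝ, 0 < C ∧ ∀ δ : ℝ, 0 < δ →
    ∃ (k₀ : ℕ) (s : ℕ → L2Mat Ω × H10 Ω) (q : L2Mat Ω × H10 Ω),
      (∀ k, k₀ ≤ k → s k ∈ Xk k) ∧ TauTendsto s q ∧ gap p q ≤ δ ∧
      limsup (fun k => (Ik k (s k) : EReal)) atTop ≤ ((I p + C * δ : ℝ) : EReal)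

namespace ControlData

variable (D : ControlData Ω)

/-- `p` is an optimal pair of the problem: `p ∈ Ξ` and `I(p) = inf_Ξ I`. -/
def IsOptimal (f : Hm1 Ω) (yd : H10 Ω) (p : L2Mat Ω × H10 Ω) : Prop :=
  p ∈ D.Xi f ∧ ∀ q ∈ D.Xi f, cost yd p ≤ cost yd q

/-- `p` is a variational solution: it is optimal, and for some `L^∞` skew-symmetric `A^*_k` with
`A^*_k → A^*` in `L²`, the control problem is the variational limit of the regularized problems
(in which the skew-symmetric parts are taken in `R`). -/
def IsVariationalSolution (R : Set (L2Mat Ω)) (f : Hm1 Ω) (yd : H10 Ω)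
    (p : L2Mat Ω × H10 Ω) : Prop :=
  D.IsOptimal f yd p ∧
    ∃ As : ℕ → L2Mat Ω, (∀ k, IsSkew (As k) ∧ MemLp (As k) ∞ (leb Ω)) ∧
      Tendsto As atTop (𝓝 D.Astar) ∧
      IsVariationalLimit (fun k => D.XiReg R (As k) f) (fun _ => cost yd) (D.Xi f) (cost yd)

end ControlData

end OCP

end

open OCP

open OCP

namespace OCP

variable {N : ℕ} {Ω : Opens (Eu N)}

/-! The functional `f` is chosen so that `(A₀, v)` is admissible: `⟨f, w⟩ = ∫ (A₀^sym ∇v, ∇w) + [v,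
w]_{A₀}`. With `y_d = v` this pair has zero cost, and the cost is nonnegative by ellipticity, so the
pair is optimal.

The obstruction to being variational is an energy identity. In the regularized problems the matrix
is bounded, so `y` itself is a legitimate test function and the skew part cancels: `∫ (A^sym ∇y, ∇y)
= ⟨f, y⟩` (`energy_of_mem_XiReg`). If `(A₀, v)` were variational, the recovery property would give
regularized pairs whose controls are close to `A₀` in `L²` and whose cost is close to zero.
Ellipticity turns the small cost into strong `H^1` closeness of the states to `v` (`le_cost`), so
the identity passes to the limit (`tendsto_pairing`) and holds for `(A₀, v)`. By the choice of `f`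
this says `[v, v]_{A₀} = 0`, contrary to `[v, v]_{A₀} < 0`. The set `R` of skew parts plays no role
in the argument, so both versions of the regularization are covered. -/

/-! ### Algebra of the pointwise bilinear form. -/

theorem mform_eq_sum (a : Mat N) (ξ η : Eu N) :
    mform a ξ η = ∑ i, ∑ j, ξ i * (a i j * η j) := by
  simp [mform, dotProduct, Matrix.mulVec, Finset.mul_sum]

theorem mform_add_left (a : Mat N) (ξ ξ' η : Eu N) :
    mform a (ξ + ξ') η = mform a ξ η + mform a ξ' η := by
  simp [mform, add_dotProduct]

theorem mform_smul_left (a : Mat N) (c : ℝ) (ξ η : Eu N) :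
    mform a (c • ξ) η = c * mform a ξ η := by
  simp [mform, smul_dotProduct]

theorem mform_sub_right (a : Mat N) (ξ η η' : Eu N) :
    mform a ξ (η - η') = mform a ξ η - mform a ξ η' := by
  simp [mform, Matrix.mulVec_sub, dotProduct_sub]

theorem mform_symm {a : Mat N} (ha : ∀ i j, a i j = a j i) (ξ η : Eu N) :
    mform a ξ η = mform a η ξ := by
  rw [mform_eq_sum, mform_eq_sum, Finset.sum_comm]
  refine Finset.sum_congr rfl fun i _ => Finset.sum_congr rfl fun j _ => ?_
  rw [ha j i]
  ring

theorem symL_apply (b : Mat N) (i j : Fin N) : symL N b i j = (1 / 2 : ℝ) * (b i j + b j i) := rfl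

theorem skewL_apply (b : Mat N) (i j : Fin N) : skewL N b i j = (1 / 2 : ℝ) * (b i j - b j i) := rfl

theorem symL_add_skewL (b : Mat N) : symL N b + skewL N b = b := by
  ext i j
  rw [Pi.add_apply, Pi.add_apply, symL_apply, skewL_apply]
  ring

theorem mform_add_mat (a b : Mat N) (ξ η : Eu N) :
    mform (a + b) ξ η = mform a ξ η + mform b ξ η := by
  simp only [mform_eq_sum, Pi.add_apply, ← Finset.sum_add_distrib]
  refine Finset.sum_congr rfl fun i _ => Finset.sum_congr rfl fun j _ => ?_
  ring

/-- Only the symmetric part of a matrix contributes to its quadratic form. -/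
theorem mform_symL_self (a : Mat N) (ξ : Eu N) : mform (symL N a) ξ ξ = mform a ξ ξ := by
  have h : mform (skewL N a) ξ ξ = 0 := by
    -- Interchanging the two summation indices changes the sign of a skew-symmetric form on the
    -- diagonal.
    have h1 : mform (skewL N a) ξ ξ = -mform (skewL N a) ξ ξ := by
      conv_lhs => rw [mform_eq_sum, Finset.sum_comm]
      rw [mform_eq_sum, ← Finset.sum_neg_distrib]
      refine Finset.sum_congr rfl fun i _ => ?_
      rw [← Finset.sum_neg_distrib]
      refine Finset.sum_congr rfl fun j _ => ?_
      rw [skewL_apply, skewL_apply]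
      ring
    linarith
  rw [← add_zero (mform (symL N a) ξ ξ), ← h, ← mform_add_mat, symL_add_skewL]

/-- The entries of a symmetric matrix with `0 ≤ a ≤ β I` are bounded by `β`. -/
theorem norm_le_of_form_bounds {a : Mat N} {β : ℝ} (hβ : 0 ≤ β) (ha : ∀ i j, a i j = a j i)
    (h : ∀ ξ : Eu N, 0 ≤ mform a ξ ξ ∧ mform a ξ ξ ≤ β * ‖ξ‖ ^ 2) : ‖a‖ ≤ β := by
  refine (pi_norm_le_iff_of_nonneg hβ).2 fun i => (pi_norm_le_iff_of_nonneg hβ).2 fun j => ?_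
  set e : Eu N := EuclideanSpace.single i 1
  set e' : Eu N := EuclideanSpace.single j 1
  have hij : mform a e e' = a i j := by
    simp [mform, e, e']
  have h1 := h (e + e')
  have h2 := h (e - e')
  -- Polarization: `4 a_ij` is a difference of two values of the quadratic form, each in `[0, 4β]`
  -- because `‖e ± e'‖ ≤ 2`.
  have e1 : mform a (e + e') (e + e') = mform a (e - e') (e - e') + 4 * a i j := by
    have hr : mform a (e + e') (e + e') = mform a e e + 2 * mform a e e' + mform a e' e' := by
      rw [mform_add_left, mform_symm ha e, mform_symm ha e', mform_add_left, mform_add_left,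
        mform_symm ha e' e]
      ring
    have hs : mform a (e - e') (e - e') = mform a e e - 2 * mform a e e' + mform a e' e' := by
      rw [mform_sub_left, mform_sub_right, mform_sub_right, mform_symm ha e' e]
      ring
    rw [hr, hs, hij]
    ring
  have n1 : ‖e‖ = 1 := by simp [e]
  have n2 : ‖e'‖ = 1 := by simp [e']
  have h3 : ‖e + e'‖ ^ 2 ≤ 2 ^ 2 := by
    have := norm_add_le e e'
    gcongr
    linarith
  have h4 : ‖e - e'‖ ^ 2 ≤ 2 ^ 2 := by
    have := norm_sub_le e e'
    gcongr
    linarith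
  have h5 := mul_le_mul_of_nonneg_left h3 hβ
  have h6 := mul_le_mul_of_nonneg_left h4 hβ
  rw [Real.norm_eq_abs, abs_le]
  constructor <;> linarith

/-! ### The pairing with an essentially bounded matrix -/

theorem norm_sq_eq_integral (g : L2Vec Ω) : ‖g‖ ^ 2 = ∫ x in (Ω : Set (Eu N)), ‖g x‖ ^ 2 := by
  rw [← real_inner_self_eq_norm_sq, L2.inner_def]
  simp only [real_inner_self_eq_norm_sq]

theorem aestronglyMeasurable_mform (B : L2Mat Ω) (g h : L2Vec Ω) :
    AEStronglyMeasurable (fun x => mform (B x) (g x) (h x)) (leb Ω) :=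
  continuous_mform.comp_aestronglyMeasurable
    ((Lp.aestronglyMeasurable B).prodMk
      ((Lp.aestronglyMeasurable _).prodMk (Lp.aestronglyMeasurable h)))

section Bounded

variable {B : L2Mat Ω} {M : ℝ}

theorem integrable_mul_norm (g h : L2Vec Ω) : Integrable (fun x => ‖g x‖ * ‖h x‖) (leb Ω) :=
  (Lp.memLp g).norm.integrable_mul (Lp.memLp h).norm

theorem ae_abs_mform_le (hB : ∀ᵐ x ∂(leb Ω), ‖B x‖ ≤ M) (g h : L2Vec Ω) :
    ∀ᵐ x ∂(leb Ω), |mform (B x) (g x) (h x)| ≤ (N : ℝ) ^ 2 * M * (‖g x‖ * ‖h x‖) := by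
  filter_upwards [hB] with x hx
  calc _ ≤ _ := mform_abs_le _ _ _
    _ ≤ (N : ℝ) ^ 2 * (‖g x‖ * (M * ‖h x‖)) := by gcongr
    _ = _ := by ring

theorem integrable_mform (hB : ∀ᵐ x ∂(leb Ω), ‖B x‖ ≤ M) (g h : L2Vec Ω) :
    Integrable (fun x => mform (B x) (g x) (h x)) (leb Ω) :=
  ((integrable_mul_norm g h).const_mul ((N : ℝ) ^ 2 * M)).mono' (aestronglyMeasurable_mform B g h)
    (ae_abs_mform_le hB g h)

theorem integral_mul_norm_le (g h : L2Vec Ω) :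
    ∫ x in (Ω : Set (Eu N)), ‖g x‖ * ‖h x‖ ≤ ‖g‖ * ‖h‖ := by
  have hg : MemLp (fun x => ‖g x‖) (ENNReal.ofReal 2) (leb Ω) := by
    simpa using (Lp.memLp g).norm
  have hh : MemLp (fun x => ‖h x‖) (ENNReal.ofReal 2) (leb Ω) := by
    simpa using (Lp.memLp h).norm
  have := integral_mul_le_Lp_mul_Lq_of_nonneg (μ := leb Ω) Real.HolderConjugate.two_two
    (ae_of_all _ fun x => norm_nonneg (g x)) (ae_of_all _ fun x => norm_nonneg (h x)) hg hh
  refine this.trans (le_of_eq ?_)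
  simp only [Real.rpow_two]
  rw [← norm_sq_eq_integral, ← norm_sq_eq_integral, ← Real.sqrt_eq_rpow, ← Real.sqrt_eq_rpow,
    Real.sqrt_sq (norm_nonneg _), Real.sqrt_sq (norm_nonneg _)]

theorem abs_pairing_le (hM : 0 ≤ M) (hB : ∀ᵐ x ∂(leb Ω), ‖B x‖ ≤ M) (g h : L2Vec Ω) :
    |pairing B g h| ≤ (N : ℝ) ^ 2 * M * (‖g‖ * ‖h‖) := by
  refine (abs_integral_le_integral_abs).trans ?_
  refine (integral_mono_ae (integrable_mform hB g h).abs
    ((integrable_mul_norm g h).const_mul ((N : ℝ) ^ 2 * M)) (ae_abs_mform_le hB g h)).trans ?_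
  rw [integral_const_mul]
  exact mul_le_mul_of_nonneg_left (integral_mul_norm_le g h) (by positivity)

theorem pairing_add_left (hB : ∀ᵐ x ∂(leb Ω), ‖B x‖ ≤ M) (g g' h : L2Vec Ω) :
    pairing B (g + g') h = pairing B g h + pairing B g' h := by
  unfold pairing
  rw [← integral_add (integrable_mform hB g h) (integrable_mform hB g' h)]
  refine integral_congr_ae ?_
  filter_upwards [Lp.coeFn_add g g'] with x hx
  rw [hx, Pi.add_apply, mform_add_left]

/-- Unlike additivity, this needs no bound on `B`: pulling a constant out of the integral is valid
even without integrability. -/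
theorem pairing_smul_left (B : L2Mat Ω) (c : ℝ) (g h : L2Vec Ω) :
    pairing B (c • g) h = c * pairing B g h := by
  unfold pairing
  rw [← integral_const_mul]
  refine integral_congr_ae ?_
  filter_upwards [Lp.coeFn_smul c g] with x hx
  rw [hx, Pi.smul_apply, mform_smul_left]

theorem pairing_sub_left (hB : ∀ᵐ x ∂(leb Ω), ‖B x‖ ≤ M) (g g' h : L2Vec Ω) :
    pairing B (g - g') h = pairing B g h - pairing B g' h := by
  unfold pairing
  rw [← integral_sub (integrable_mform hB g h) (integrable_mform hB g' h)]
  refine integral_congr_ae ?_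
  filter_upwards [Lp.coeFn_sub g g'] with x hx
  rw [hx, Pi.sub_apply, mform_sub_left]

theorem pairing_sub_right (hB : ∀ᵐ x ∂(leb Ω), ‖B x‖ ≤ M) (g h h' : L2Vec Ω) :
    pairing B g (h - h') = pairing B g h - pairing B g h' := by
  unfold pairing
  rw [← integral_sub (integrable_mform hB g h) (integrable_mform hB g h')]
  refine integral_congr_ae ?_
  filter_upwards [Lp.coeFn_sub h h'] with x hx
  rw [hx, Pi.sub_apply, mform_sub_right]

end Bounded

/-- `w ↦ ∫ (∇w, B h)` as an element of `H^{-1}(Ω)`, for an essentially bounded matrix `B`. -/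
noncomputable def pairingCLM (B : L2Mat Ω) (M : ℝ) (hM : 0 ≤ M) (hB : ∀ᵐ x ∂(leb Ω), ‖B x‖ ≤ M)
    (h : L2Vec Ω) : Hm1 Ω :=
  LinearMap.mkContinuous
    { toFun := fun w => pairing B (grad w) h
      map_add' := fun w w' => pairing_add_left hB (grad w) (grad w') h
      map_smul' := fun c w => pairing_smul_left B c (grad w) h }
    ((N : ℝ) ^ 2 * M * ‖h‖) fun w => by
      refine (abs_pairing_le hM hB (grad w) h).trans ?_
      have hw : ‖grad w‖ ≤ ‖w‖ := norm_snd_le w.1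
      calc (N : ℝ) ^ 2 * M * (‖grad w‖ * ‖h‖) ≤ (N : ℝ) ^ 2 * M * (‖w‖ * ‖h‖) := by gcongr
        _ = _ := by ring

theorem pairingCLM_apply (B : L2Mat Ω) (M : ℝ) (hM : 0 ≤ M) (hB : ∀ᵐ x ∂(leb Ω), ‖B x‖ ≤ M)
    (h : L2Vec Ω) (w : H10 Ω) : pairingCLM B M hM hB h w = pairing B (grad w) h := rfl

/-! ### The extended form -/

theorem ofTest_add (φ ψ : 𝓓(Ω, ℝ)) : ofTest (φ + ψ) = ofTest φ + ofTest ψ :=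
  Subtype.ext (map_add (testPair Ω) φ ψ)

theorem ofTest_smul (c : ℝ) (φ : 𝓓(Ω, ℝ)) : ofTest (c • φ) = c • ofTest φ :=
  Subtype.ext (map_smul (testPair Ω) c φ)

/-- Here `B` may be unbounded; integrability comes from the bounded gradients of test functions. -/
theorem pairing_test_add (B : L2Mat Ω) (h : L2Vec Ω) (φ ψ : 𝓓(Ω, ℝ)) :
    pairing B (grad (ofTest (φ + ψ))) h =
      pairing B (grad (ofTest φ)) h + pairing B (grad (ofTest ψ)) h := by
  unfold pairing
  rw [← integral_add (integrable_mform_test _ φ _) (integrable_mform_test _ ψ _)]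
  refine integral_congr_ae ?_
  have hg : grad (ofTest (φ + ψ)) = grad (ofTest φ) + grad (ofTest ψ) := by
    rw [ofTest_add]
    rfl
  rw [hg]
  filter_upwards [Lp.coeFn_add (grad (ofTest φ)) (grad (ofTest ψ))] with x hx
  rw [hx, Pi.add_apply, mform_add_left]

theorem exists_seq_test (w : H10 Ω) :
    ∃ φ : ℕ → 𝓓(Ω, ℝ), Tendsto (fun n => ofTest (φ n)) atTop (𝓝 w) := by
  obtain ⟨u, hu, hw⟩ := mem_closure_iff_seq_limit.1 (denseRange_ofTest w)
  choose φ hφ using hu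
  exact ⟨φ, by simpa only [hφ] using hw⟩

section Bracket

variable {A : L2Mat Ω} {y : H10 Ω}

theorem tendsto_bracket_seq (hy : y ∈ domD A) {w : H10 Ω} {φ : ℕ → 𝓓(Ω, ℝ)}
    (hφ : Tendsto (fun n => ofTest (φ n)) atTop (𝓝 w)) :
    Tendsto (fun n => pairing (skewPart A) (grad (ofTest (φ n))) (grad y)) atTop
      (𝓝 (bracket A y w)) :=
  (tendsto_bracket hy w).comp (tendsto_comap_iff.2 hφ)

theorem bracket_ofTest (hy : y ∈ domD A) (φ : 𝓓(Ω, ℝ)) :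
    bracket A y (ofTest φ) = pairing (skewPart A) (grad (ofTest φ)) (grad y) :=
  tendsto_nhds_unique (tendsto_bracket_seq hy (φ := fun _ => φ) tendsto_const_nhds)
    tendsto_const_nhds

theorem bracket_add (hy : y ∈ domD A) (w w' : H10 Ω) :
    bracket A y (w + w') = bracket A y w + bracket A y w' := by
  obtain ⟨φ, hφ⟩ := exists_seq_test w
  obtain ⟨ψ, hψ⟩ := exists_seq_test w'
  have h : Tendsto (fun n => ofTest (φ n + ψ n)) atTop (𝓝 (w + w')) := by
    simpa only [ofTest_add] using hφ.add hψ
  refine tendsto_nhds_unique (tendsto_bracket_seq hy h) ?_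
  simpa only [pairing_test_add] using (tendsto_bracket_seq hy hφ).add (tendsto_bracket_seq hy hψ)

theorem bracket_smul (hy : y ∈ domD A) (c : ℝ) (w : H10 Ω) :
    bracket A y (c • w) = c * bracket A y w := by
  obtain ⟨φ, hφ⟩ := exists_seq_test w
  have h : Tendsto (fun n => ofTest (c • φ n)) atTop (𝓝 (c • w)) := by
    simpa only [ofTest_smul] using hφ.const_smul c
  refine tendsto_nhds_unique (tendsto_bracket_seq hy h) ?_
  have hg : ∀ n, pairing (skewPart A) (grad (ofTest (c • φ n))) (grad y) =
      c * pairing (skewPart A) (grad (ofTest (φ n))) (grad y) := fun n => by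
    rw [ofTest_smul]
    exact pairing_smul_left _ c _ _
  simpa only [hg] using (tendsto_bracket_seq hy hφ).const_mul c

theorem exists_abs_bracket_le (hy : y ∈ domD A) : ∃ c : ℝ, ∀ w, |bracket A y w| ≤ c * ‖w‖ := by
  obtain ⟨c, hc⟩ := id hy
  -- The constant from `domD` has no prescribed sign; `|c|` allows passing from the gradient norm to
  -- the larger `H^1` norm.
  refine ⟨|c|, fun w => ?_⟩
  obtain ⟨φ, hφ⟩ := exists_seq_test w
  refine le_of_tendsto_of_tendsto' (tendsto_bracket_seq hy hφ).abs (hφ.norm.const_mul |c|)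
    fun n => (hc (φ n)).trans ?_
  have h1 : ‖grad (ofTest (φ n))‖ ≤ ‖ofTest (φ n)‖ := norm_snd_le (ofTest (φ n)).1
  gcongr
  exact le_abs_self c

/-- This functional is the skew contribution to `f`. -/
theorem exists_bracketCLM (hy : y ∈ domD A) : ∃ l : Hm1 Ω, ∀ w, l w = bracket A y w := by
  obtain ⟨c, hc⟩ := exists_abs_bracket_le hy
  exact ⟨LinearMap.mkContinuous
    { toFun := bracket A y
      map_add' := bracket_add hy
      map_smul' := bracket_smul hy } c hc, fun _ => rfl⟩

end Bracket

/-! ### Symmetric and skew-symmetric parts -/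

theorem symPart_ae (A : L2Mat Ω) : ∀ᵐ x ∂(leb Ω), symPart A x = symL N (A x) :=
  (symL N).coeFn_compLp A

theorem skewPart_ae (A : L2Mat Ω) : ∀ᵐ x ∂(leb Ω), skewPart A x = skewL N (A x) :=
  (skewL N).coeFn_compLp A

theorem pairing_symPart_self (A : L2Mat Ω) (g : L2Vec Ω) :
    pairing (symPart A) g g = pairing A g g := by
  refine integral_congr_ae ?_
  filter_upwards [symPart_ae A] with x hx
  rw [hx, mform_symL_self]

theorem cost_self (A : L2Mat Ω) (v : H10 Ω) : cost v (A, v) = 0 := by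
  have h : pairing (symPart A) (0 : L2Vec Ω) 0 = 0 := by
    simpa using pairing_smul_left (symPart A) 0 (0 : L2Vec Ω) 0
  simp [cost, h]

theorem pairing_symPart_add_skewPart_test (A : L2Mat Ω) (φ : 𝓓(Ω, ℝ)) (h : L2Vec Ω) :
    pairing (symPart A) (grad (ofTest φ)) h + pairing (skewPart A) (grad (ofTest φ)) h =
      pairing A (grad (ofTest φ)) h := by
  unfold pairing
  rw [← integral_add (integrable_mform_test _ φ _) (integrable_mform_test _ φ _)]
  refine integral_congr_ae ?_
  filter_upwards [symPart_ae A, skewPart_ae A] with x h1 h2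
  rw [h1, h2, ← mform_add_mat, symL_add_skewL]

/-! ### Ellipticity, and the energy identity for the regularized problems. -/

namespace ControlData

variable {D : ControlData Ω}

theorem β_nonneg (D : ControlData Ω) : 0 ≤ D.β := D.α_pos.le.trans D.α_le_β

theorem norm_le_of_mem_Ub1 {S : L2Mat Ω} (hS : S ∈ D.Ub1) : ∀ᵐ x ∂(leb Ω), ‖S x‖ ≤ D.β := by
  filter_upwards [hS.1, hS.2.2] with x h1 h2
  exact norm_le_of_form_bounds D.β_nonneg h1 fun ξ =>
    ⟨(mul_nonneg D.α_pos.le (sq_nonneg _)).trans (h2 ξ).1, (h2 ξ).2⟩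

theorem coercive_of_mem_Ub1 {S : L2Mat Ω} (hS : S ∈ D.Ub1) (g : L2Vec Ω) :
    D.α * ‖g‖ ^ 2 ≤ pairing S g g := by
  rw [norm_sq_eq_integral, ← integral_const_mul]
  refine integral_mono_ae ?_ (integrable_mform (norm_le_of_mem_Ub1 hS) g g) ?_
  · have := integrable_mul_norm g g
    simp only [← sq] at this
    exact this.const_mul _
  · filter_upwards [hS.2.2] with x hx
    exact (hx (g x)).1

/-- Since `α` does not depend on the control, small cost forces strong `H^1` closeness to `yd`,
uniformly over the symmetric parts. -/
theorem le_cost {p : L2Mat Ω × H10 Ω} (hp : symPart p.1 ∈ D.Ub1) (yd : H10 Ω) :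
    ‖val p.2 - val yd‖ ^ 2 + D.α * ‖grad p.2 - grad yd‖ ^ 2 ≤ cost yd p :=
  add_le_add le_rfl (coercive_of_mem_Ub1 hp _)

/-- Controls of the regularized problems are essentially bounded. -/
theorem exists_norm_le_of_mem_XiReg {R : Set (L2Mat Ω)} {Ak : L2Mat Ω} {f : Hm1 Ω}
    {p : L2Mat Ω × H10 Ω} (hAk : MemLp Ak ∞ (leb Ω)) (hp : p ∈ D.XiReg R Ak f) :
    ∃ M : ℝ, 0 ≤ M ∧ ∀ᵐ x ∂(leb Ω), ‖p.1 x‖ ≤ M := by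
  obtain ⟨K, hK⟩ : ∃ K : ℝ, ∀ᵐ x ∂(leb Ω), ‖Ak x‖ ≤ K := by
    refine ⟨(eLpNormEssSup Ak (leb Ω)).toReal, ?_⟩
    have hfin : eLpNormEssSup Ak (leb Ω) ≠ ∞ := by
      simpa using hAk.eLpNorm_ne_top
    filter_upwards [ae_le_eLpNormEssSup (f := Ak) (μ := leb Ω)] with x hx
    simpa using ENNReal.toReal_mono hfin hx
  refine ⟨D.β + |K|, add_nonneg D.β_nonneg (abs_nonneg K), ?_⟩
  filter_upwards [norm_le_of_mem_Ub1 hp.1.2, hp.2.1.2.1, hp.2.1.2.2, hK, symPart_ae p.1,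
    skewPart_ae p.1] with x h1 h2 h3 h4 h5 h6
  rw [← symL_add_skewL (p.1 x), ← h5, ← h6]
  have hent : ∀ i j, |Ak x i j| ≤ |K| := fun i j =>
    ((norm_le_pi_norm (Ak x i) j).trans (norm_le_pi_norm (Ak x) i)).trans (h4.trans (le_abs_self K))
  refine (norm_add_le _ _).trans (add_le_add h1 ?_)
  refine (pi_norm_le_iff_of_nonneg (abs_nonneg K)).2 fun i =>
    (pi_norm_le_iff_of_nonneg (abs_nonneg K)).2 fun j => ?_
  rw [Real.norm_eq_abs]
  -- `Preceq` controls only the entries above the diagonal; skew-symmetry gives the rest.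
  rcases lt_trichotomy i j with h | rfl | h
  · exact (h3 i j h).trans (hent i j)
  · have : skewPart p.1 x i i = 0 := by linarith [h2 i i]
    rw [this, abs_zero]
    exact abs_nonneg K
  · rw [h2 i j, abs_neg]
    exact (h3 j i h).trans (hent j i)

/-- The energy identity for the regularized problems. -/
theorem energy_of_mem_XiReg {R : Set (L2Mat Ω)} {Ak : L2Mat Ω} {f : Hm1 Ω}
    {p : L2Mat Ω × H10 Ω} (hAk : MemLp Ak ∞ (leb Ω)) (hp : p ∈ D.XiReg R Ak f) :
    pairing (symPart p.1) (grad p.2) (grad p.2) = f p.2 := by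
  obtain ⟨M, hM, hB⟩ := exists_norm_le_of_mem_XiReg hAk hp
  -- Boundedness of the matrix makes both sides continuous in the test function, so the weak
  -- equation extends by density to all of `H^1_0(Ω)`, including `p.2`.
  have h : (pairingCLM p.1 M hM hB (grad p.2) : H10 Ω → ℝ) = f :=
    denseRange_ofTest.equalizer (pairingCLM p.1 M hM hB (grad p.2)).continuous f.continuous
      (funext hp.2.2)
  rw [pairing_symPart_self, ← congrFun h p.2]
  rfl

end ControlData

/-! ### Passage to the limit in the energy identity -/

/-- With the vector field frozen at `g₀`, dominated convergence applies; the error from replacing `g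
n` by `g₀` is controlled by the uniform bound `M`. -/
theorem tendsto_pairing {B : ℕ → L2Mat Ω} {B₀ : L2Mat Ω} {M : ℝ} (hM : 0 ≤ M)
    (hB : ∀ n, ∀ᵐ x ∂(leb Ω), ‖B n x‖ ≤ M)
    (hlim : ∀ᵐ x ∂(leb Ω), Tendsto (fun n => B n x) atTop (𝓝 (B₀ x)))
    {g : ℕ → L2Vec Ω} {g₀ : L2Vec Ω} (hg : Tendsto g atTop (𝓝 g₀)) :
    Tendsto (fun n => pairing (B n) (g n) (g n)) atTop (𝓝 (pairing B₀ g₀ g₀)) := by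
  have h0 : Tendsto (fun n => pairing (B n) g₀ g₀) atTop (𝓝 (pairing B₀ g₀ g₀)) := by
    have hptw : ∀ᵐ x ∂(leb Ω), Tendsto (fun n => mform (B n x) (g₀ x) (g₀ x)) atTop
        (𝓝 (mform (B₀ x) (g₀ x) (g₀ x))) := by
      filter_upwards [hlim] with x hx
      have hc : Continuous fun a : Mat N => mform a (g₀ x) (g₀ x) :=
        continuous_mform.comp (continuous_id.prodMk (continuous_const (y := (g₀ x, g₀ x))))
      exact (hc.tendsto (B₀ x)).comp hx
    have hdom : Integrable (fun x => (N : ℝ) ^ 2 * M * (‖g₀ x‖ * ‖g₀ x‖)) (leb Ω) :=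
      (integrable_mul_norm g₀ g₀).const_mul _
    exact tendsto_integral_of_dominated_convergence
      (F := fun n x => mform (B n x) (g₀ x) (g₀ x)) (f := fun x => mform (B₀ x) (g₀ x) (g₀ x))
      _ (fun n => aestronglyMeasurable_mform (B n) g₀ g₀) hdom
      (fun n => ae_abs_mform_le (hB n) g₀ g₀) hptw
  have hd : Tendsto (fun n => g n - g₀) atTop (𝓝 0) := tendsto_sub_nhds_zero_iff.2 hg
  have hz : ∀ {u w : ℕ → L2Vec Ω} {u₀ w₀ : L2Vec Ω}, Tendsto u atTop (𝓝 u₀) →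
      Tendsto w atTop (𝓝 w₀) → ‖u₀‖ * ‖w₀‖ = 0 →
      Tendsto (fun n => pairing (B n) (u n) (w n)) atTop (𝓝 0) := fun {u w u₀ w₀} hu hw h =>
    squeeze_zero_norm (fun n => abs_pairing_le hM (hB n) (u n) (w n)) (by
      simpa [h] using (hu.norm.mul hw.norm).const_mul ((N : ℝ) ^ 2 * M))
  -- The splitting is `(g, B g) = (g - g₀, B g) + (g₀, B (g - g₀)) + (g₀, B g₀)`.
  have h1 := hz hd hg (by simp)
  have h2 := hz (u := fun _ => g₀) tendsto_const_nhds hd (by simp)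
  have := (h1.add h2).add h0
  simp only [zero_add] at this
  refine this.congr fun n => ?_
  rw [pairing_sub_left (hB n), pairing_sub_right (hB n)]
  ring

namespace ControlData

variable {D : ControlData Ω}

/-- Near a pair `(A₀, v)` of vanishing cost that is reached by recovery sequences there are pairs
satisfying the energy identity. -/
theorem exists_energy_near {R : Set (L2Mat Ω)} {f : Hm1 Ω} {A₀ : L2Mat Ω} {v : H10 Ω}
    (hmem : (A₀, v) ∈ D.Xi f) (hvar : D.IsVariationalSolution R f v (A₀, v)) {ε : ℝ} (hε : 0 < ε) :
    ∃ p : L2Mat Ω × H10 Ω, symPart p.1 ∈ D.Ub1 ∧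
      pairing (symPart p.1) (grad p.2) (grad p.2) = f p.2 ∧
      ‖p.1 - A₀‖ ≤ ε ∧ cost v p ≤ ε := by
  obtain ⟨-, As, hAs, -, hlim⟩ := hvar
  obtain ⟨C, hC, hrec⟩ := hlim.recovery _ hmem
  -- The first bound on `δ` leaves `ε / 2` for the convergence of the controls to `q.1`; the second
  -- keeps the excess cost `C * δ` at most `ε / 2`.
  obtain ⟨k₀, s, q, hs, hτ, hgap, hsup⟩ := hrec (min (ε / 2) (ε / (2 * C))) (by positivity)
  have hq : ‖q.1 - A₀‖ ≤ ε / 2 := by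
    rw [norm_sub_rev]
    exact (le_add_of_nonneg_right (norm_nonneg _)).trans (hgap.trans (min_le_left _ _))
  have hlt : limsup (fun k => (cost v (s k) : EReal)) atTop < ((ε : ℝ) : EReal) := by
    refine hsup.trans_lt (EReal.coe_lt_coe_iff.2 ?_)
    rw [cost_self, zero_add]
    calc C * min (ε / 2) (ε / (2 * C)) ≤ C * (ε / (2 * C)) := by
          gcongr
          exact min_le_right _ _
      _ = ε / 2 := by field_simp
      _ < ε := half_lt_self hε
  obtain ⟨k, hk1, hk2, hk3⟩ := ((eventually_lt_of_limsup_lt hlt).and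
    ((Metric.tendsto_nhds.1 hτ.1 (ε / 2) (half_pos hε)).and (eventually_ge_atTop k₀))).exists
  have hsk := hs k hk3
  refine ⟨s k, hsk.1.2, energy_of_mem_XiReg (hAs k).2 hsk, ?_, (EReal.coe_lt_coe_iff.1 hk1).le⟩
  rw [dist_eq_norm] at hk2
  have := norm_sub_le_norm_sub_add_norm_sub (s k).1 q.1 A₀
  linarith

/-- The convergence in `TauTendsto` is only weak in the states, which would not suffice for a
quadratic energy. Strong convergence is obtained instead from the vanishing cost. -/
theorem energy_of_isVariationalSolution {R : Set (L2Mat Ω)} {f : Hm1 Ω} {A₀ : L2Mat Ω} {v : H10 Ω}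
    (hmem : (A₀, v) ∈ D.Xi f) (hvar : D.IsVariationalSolution R f v (A₀, v)) :
    pairing (symPart A₀) (grad v) (grad v) = f v := by
  choose p hp1 hp2 hp3 hp4 using fun n : ℕ =>
    exists_energy_near hmem hvar (ε := 1 / ((n : ℝ) + 1)) (by positivity)
  have hε : Tendsto (fun n : ℕ => 1 / ((n : ℝ) + 1)) atTop (𝓝 0) :=
    tendsto_one_div_add_atTop_nhds_zero_nat
  have hA : Tendsto (fun n => (p n).1) atTop (𝓝 A₀) :=
    tendsto_iff_norm_sub_tendsto_zero.2 (squeeze_zero (fun _ => norm_nonneg _) hp3 hε)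
  have hsq : ∀ {E : Type} [NormedAddCommGroup E] {u : ℕ → E} {u₀ : E},
      Tendsto (fun n => ‖u n - u₀‖ ^ 2) atTop (𝓝 0) → Tendsto u atTop (𝓝 u₀) :=
    fun {E} _ {u u₀} h => tendsto_iff_norm_sub_tendsto_zero.2 (by
      simpa [Real.sqrt_sq] using h.sqrt)
  have hval : Tendsto (fun n => val (p n).2) atTop (𝓝 (val v)) := by
    refine hsq (squeeze_zero (fun _ => sq_nonneg _) (fun n => ?_) hε)
    have := (le_cost (hp1 n) v).trans (hp4 n)
    have := mul_nonneg D.α_pos.le (sq_nonneg ‖grad (p n).2 - grad v‖)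
    linarith
  have hgrad : Tendsto (fun n => grad (p n).2) atTop (𝓝 (grad v)) := by
    have hε' : Tendsto (fun n : ℕ => D.α⁻¹ * (1 / ((n : ℝ) + 1))) atTop (𝓝 0) := by
      simpa only [mul_zero] using hε.const_mul D.α⁻¹
    refine hsq (squeeze_zero (fun _ => sq_nonneg _) (fun n => ?_) hε')
    have h1 := (le_cost (hp1 n) v).trans (hp4 n)
    rw [le_inv_mul_iff₀ D.α_pos]
    exact (le_add_of_nonneg_left (sq_nonneg _)).trans h1
  have hy : Tendsto (fun n => (p n).2) atTop (𝓝 v) :=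
    tendsto_subtype_rng.2 (hval.prodMk_nhds hgrad)
  -- `L²` convergence of the controls yields a.e. convergence along a subsequence; the symmetric
  -- parts are uniformly bounded by `β`, as `tendsto_pairing` requires.
  obtain ⟨ns, hns, hae⟩ := (tendstoInMeasure_of_tendsto_Lp hA).exists_seq_tendsto_ae
  have hlim : ∀ᵐ x ∂(leb Ω),
      Tendsto (fun k => symPart (p (ns k)).1 x) atTop (𝓝 (symPart A₀ x)) := by
    filter_upwards [hae, ae_all_iff.2 fun k => symPart_ae (p (ns k)).1, symPart_ae A₀]
      with x h1 h2 h3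
    simp only [h2, h3]
    exact ((symL N).continuous.tendsto _).comp h1
  have h1 := tendsto_pairing D.β_nonneg (fun k => norm_le_of_mem_Ub1 (hp1 (ns k))) hlim
    (hgrad.comp hns.tendsto_atTop)
  refine tendsto_nhds_unique h1 ?_
  refine (((f.continuous.tendsto v).comp hy).comp hns.tendsto_atTop).congr fun k => ?_
  exact (hp2 (ns k)).symm

end ControlData

end OCP

/-! ### Choice of `f`, optimality and the contradiction. -/

theorem lemma4p21 {N : ℕ} (hN : 2 ≤ N) (Ω : TopologicalSpace.Opens (Eu N))
    (hΩ_bdd : Bornology.IsBounded (Ω : Set (Eu N))) (hΩ_conn : IsConnected (Ω : Set (Eu N)))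
    (hΩ_lip : HasLipschitzBoundary Ω) (D : ControlData Ω)
    (A₀ : L2Mat Ω) (hA₀ : A₀ ∈ D.Aad) (v : H10 Ω) (hv : v ∈ domD A₀)
    (hneg : bracket A₀ v v < 0) :
    ∃ f : Hm1 Ω,
      -- `f = -div (A₀ ∇v)` in the sense of distributions
      (∀ φ : 𝓓(Ω, ℝ), f (ofTest φ) = pairing A₀ (grad (ofTest φ)) (grad v)) ∧
      -- `(A₀, v)` is optimal for the problem with data `f` and `y_d = v`
      D.IsOptimal f v (A₀, v) ∧
      -- it is not a variational solution, when the regularized skew parts satisfy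
      -- `B ⪯ A^*`, `B ⪯ A^*_k`
      ¬ D.IsVariationalSolution D.Ua2 f v (A₀, v) ∧
      -- and neither if they are required to lie in `Q` as well
      ¬ D.IsVariationalSolution D.Aad2 f v (A₀, v) := by
  have hS := ControlData.norm_le_of_mem_Ub1 hA₀.1.2
  obtain ⟨l, hl⟩ := exists_bracketCLM hv
  set f : Hm1 Ω := pairingCLM (symPart A₀) D.β D.β_nonneg hS (grad v) + l with hf
  have hfw : ∀ w, f w = pairing (symPart A₀) (grad w) (grad v) + bracket A₀ v w := fun w => by
    rw [hf, add_apply, pairingCLM_apply, hl]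
  have hmem : (A₀, v) ∈ D.Xi f := ⟨hA₀, hv, fun w => (hfw w).symm⟩
  have hnot : ∀ R, ¬ D.IsVariationalSolution R f v (A₀, v) := fun R hR => by
    -- Comparing this identity with the formula for `f v` leaves `bracket A₀ v v = 0`.
    have h1 := ControlData.energy_of_isVariationalSolution hmem hR
    rw [hfw v] at h1
    linarith
  refine ⟨f, fun φ => ?_, ⟨hmem, fun q hq => ?_⟩, hnot _, hnot _⟩
  · rw [hfw, bracket_ofTest hv, pairing_symPart_add_skewPart_test]
  · rw [cost_self]
    refine le_trans ?_ (ControlData.le_cost hq.1.1.2 v)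
    have := D.α_pos
    positivity
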